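/- Let $\mathbb{T}^3=(\mathbb{R}/2\pi\mathbb{Z})^3$, $\mathbb{Z}^3_\star=\mathbb{Z}^3\setminus\{0\}$, $|\nabla|=\sqrt{-\Delta}$, $\langle\cdot\rangle=(1+|\cdot|^2)^{1/2}$. For a Fourier series with real coefficients $$u(x)=a+\sum_{n\in\mathbb{Z}^3_\star}\big(b_n\cos(n\cdot x)+c_n\sin(n\cdot x)\big)$$ and $s\in\mathbb{R}$ put $$\|u\|_{H^s}^2=a^2+\sum_{n\in\mathbb{Z}^3_\star}\langle n\rangle^{2s}(b_n^2+c_n^2)\in[0,\infty]$$ (if $b_{-n}=b_n$ and $c_{-n}=-c_n$ this is $\sum_{n}\langle n\rangle^{2s}|\hat u(n)|^2$), and let $\mathcal{H}^s=H^s\times H^{s-1}$, with $\|(u_0,u_1)\|_{\mathcal{H}^s}^2=\|u_0\|_{H^s}^2+\|u_1\|_{H^{s-1}}^2$. Define $$S(t)(u_0,u_1)=\cos(t|\nabla|)u_0+\frac{\sin(t|\nabla|)}{|\nabla|}u_1,\qquad \tilde S(t)(u_0,u_1)=-\frac{|\nabla|}{\langle\nabla\rangle}\sin(t|\nabla|)u_0+\frac{\cos(t|\nabla|)}{\langle\nabla\rangle}u_1,$$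 where $\sin(t|\nabla|)/|\nabla|$ acts on constants as multiplication by $t$. **Proposition.** Let $K>0$, $2\le r\le\infty$ and $\varepsilon>0$. There are constants $C,c>0$, depending only on $K$, $r$ and $\varepsilon$, such that the following holds. Let $(\alpha_j,\beta_{n,j},\gamma_{n,j})_{n\in\mathbb{Z}^3_\star,\,j=0,1}$ be independent identically distributed real random variables on a probability space $(\Omega,\mathcal{A},\mathbb{P})$ whose common law $\theta$ satisfies $\int_{\mathbb{R}}e^{\gamma x}\,d\theta(x)\le e^{K\gamma^2}$ for all $\gamma\in\mathbb{R}$. Let $s\in\mathbb{R}$ and let $(u_0,u_1)\in\mathcal{H}^s(\mathbb{T}^3)$ be given by $$u_j(x)=a_j+\sum_{n\in\mathbb{Z}^3_\star}\big(b_{n,j}\cos(n\cdot x)+c_{n,j}\sin(n\cdot x)\big),\qquad j=0,1,$$ with real coefficients, and let $$u_j^\omega(x)=\alpha_j(\omega)a_j+\sum_{n\in\mathbb{Z}^3_\star}\big(\beta_{n,j}(\omega)b_{n,j}\cos(n\cdot x)+\gamma_{n,j}(\omega)c_{n,j}\sin(n\cdot x)\big).$$ Let $T>0$ and let $S^*(t)=S(t)$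 for all $t$ or $S^*(t)=\tilde S(t)$ for all $t$. Then for every $\lambda>0$ $$\mathbb{P}\Big(\|S^*(t)(u_0^\omega,u_1^\omega)\|_{L^\infty_tL^r_x([0,T]\times\mathbb{T}^3)}>\lambda\Big)\le C\exp\Big(-c\,\frac{\lambda^2}{\max(1,T^2)\,\|(u_0,u_1)\|_{\mathcal{H}^\varepsilon}^2}\Big).$$ Here the $L^r_x$ norm of a distribution which is not a function in $L^r(\mathbb{T}^3)$ is $\infty$, and the right-hand side is $C$ if $\|(u_0,u_1)\|_{\mathcal{H}^\varepsilon}=\infty$ and $0$ if $\|(u_0,u_1)\|_{\mathcal{H}^\varepsilon}=0$. -/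

import Mathlib

open MeasureTheory ProbabilityTheory
open scoped ENNReal

noncomputable section

namespace RandomWave

/-- The circumference `2π` is positive (this gives `ℝ / 2πℤ` its Lebesgue measure). -/
instance factTwoPiPos : Fact (0 < 2 * Real.pi) := ⟨Real.two_pi_pos⟩

/-- The torus `𝕋³ = (ℝ / 2πℤ)³`, with Lebesgue measure (of total mass `(2π)³`). -/
abbrev T3 : Type := Fin 3 → AddCircle (2 * Real.pi)

/-- The frequency lattice `ℤ³`. -/
abbrev Z3 : Type := Fin 3 → ℤ

/-- The nonzero frequencies `ℤ³ \ {0}`. -/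
abbrev Z3Star : Type := {n : Z3 // n ≠ 0}

/-- Euclidean length `|n|` of a frequency. -/
def freqNorm (n : Z3) : ℝ := Real.sqrt (∑ i, (n i : ℝ) ^ 2)

/-- Japanese bracket `⟨ρ⟩ = (1 + ρ²)^{1/2}`. -/
def japanese (ρ : ℝ) : ℝ := Real.sqrt (1 + ρ ^ 2)

/-- The character `x ↦ e^{i n·x}` of `𝕋³`. -/
def character (n : Z3) (x : T3) : ℂ := ∏ i, fourier (n i) (x i)

/-- The terms of a real Fourier series on `𝕋³`: the constant `1`, and `cos(n·x)`, `sin(n·x)` for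
every `n ∈ ℤ³ \ {0}`. -/
inductive TrigMode : Type
  | const : TrigMode
  | cosine (n : Z3Star) : TrigMode
  | sine (n : Z3Star) : TrigMode

/-- The frequency of a term (`0` for the constant). -/
def TrigMode.freq : TrigMode → Z3
  | .const => 0
  | .cosine n => n.1
  | .sine n => n.1

/-- A Fourier series `a + ∑_{n ≠ 0} (b_n cos(n·x) + c_n sin(n·x))` with real coefficients, given by
its coefficients `a = u const`, `b_n = u (cosine n)`, `c_n = u (sine n)`. -/
abbrev RealSeries : Type := TrigMode → ℝ

/-- `b_n`, with the value `0` at `n = 0`. -/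
def cosCoeff (u : RealSeries) (n : Z3) : ℝ := if h : n ≠ 0 then u (.cosine ⟨n, h⟩) else 0

/-- `c_n`, with the value `0` at `n = 0`. -/
def sinCoeff (u : RealSeries) (n : Z3) : ℝ := if h : n ≠ 0 then u (.sine ⟨n, h⟩) else 0

/-- The `n`-th complex Fourier coefficient (the coefficient of `e^{i n·x}`) of the series `u`:
`a` if `n = 0`, and `((b_n + b_{-n}) - i (c_n - c_{-n})) / 2` otherwise. -/
def fourierCoefficient (u : RealSeries) (n : Z3) : ℂ :=
  if n = 0 then (u .const : ℂ)
  else (((cosCoeff u n + cosCoeff u (-n) : ℝ) : ℂ)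
    - Complex.I * ((sinCoeff u n - sinCoeff u (-n) : ℝ) : ℂ)) / 2

/-- The square of the Sobolev norm,
`‖u‖²_{H^s} = a² + ∑_{n ≠ 0} ⟨n⟩^{2s} (b_n² + c_n²)`, with values in `[0, ∞]`.

For the Fourier series of a real distribution, in which `b_{-n} = b_n` and `c_{-n} = -c_n`, this is
`∑_n ⟨n⟩^{2s} |û(n)|²` (see `sobolevSq_eq` below); for a series in which only one of `n`, `-n` occurs
it is this quantity up to a factor between `1` and `2`. (A series with, say, `b_{-n} = -b_n` would
be a redundant expression of the zero function whose randomization is not zero; the norm is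
therefore taken of the coefficients that are randomized.) -/
def sobolevSq (s : ℝ) (u : RealSeries) : ℝ≥0∞ :=
  ∑' m : TrigMode, ENNReal.ofReal (japanese (freqNorm m.freq) ^ (2 * s) * u m ^ 2)

/-- The splitting of the terms into the constant, the cosines and the sines. -/
def trigModeEquiv : Unit ⊕ (Z3Star ⊕ Z3Star) ≃ TrigMode where
  toFun
    | .inl _ => .const
    | .inr (.inl n) => .cosine n
    | .inr (.inr n) => .sine n
  invFun
    | .const => .inl ()
    | .cosine n => .inr (.inl n)
    | .sine n => .inr (.inr n)
  left_inv := by rintro (_ | _ | _) <;> rfl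
  right_inv := by rintro (_ | _ | _) <;> rfl

/-- If `b_{-n} = b_n` and `c_{-n} = -c_n`, then `‖u‖²_{H^s} = ∑_n ⟨n⟩^{2s} |û(n)|²`. -/
theorem sobolevSq_eq (s : ℝ) (u : RealSeries) (hb : ∀ n, cosCoeff u (-n) = cosCoeff u n)
    (hc : ∀ n, sinCoeff u (-n) = -sinCoeff u n) :
    sobolevSq s u = ∑' n : Z3,
      ENNReal.ofReal (japanese (freqNorm n) ^ (2 * s) * ‖fourierCoefficient u n‖ ^ 2) := by
  have hj : ∀ ρ, 0 ≤ japanese ρ := fun ρ => Real.sqrt_nonneg _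
  have key : ∀ n : Z3Star, ‖fourierCoefficient u n.1‖ ^ 2
      = u (.cosine n) ^ 2 + u (.sine n) ^ 2 := by
    intro n
    have h1 : cosCoeff u n.1 = u (.cosine n) := by simp [cosCoeff, n.2]
    have h2 : sinCoeff u n.1 = u (.sine n) := by simp [sinCoeff, n.2]
    rw [fourierCoefficient, if_neg n.2, hb, hc, h1, h2, Complex.sq_norm, Complex.normSq_apply]
    simp
    ring
  have h0 : ‖fourierCoefficient u 0‖ ^ 2 = u .const ^ 2 := by
    simp [fourierCoefficient]
  rw [sobolevSq, ← trigModeEquiv.tsum_eq, ENNReal.summable.tsum_sum ENNReal.summable,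
    ENNReal.summable.tsum_sum ENNReal.summable, ← ENNReal.tsum_add,
    ← ENNReal.summable.tsum_add_tsum_compl (s := ({0} : Set Z3)) ENNReal.summable]
  congr 1
  · rw [tsum_singleton 0 (fun n : Z3 => ENNReal.ofReal
      (japanese (freqNorm n) ^ (2 * s) * ‖fourierCoefficient u n‖ ^ 2)), h0]
    simp [trigModeEquiv, TrigMode.freq]
  · refine tsum_congr fun n : Z3Star => ?_
    have hw : 0 ≤ japanese (freqNorm n.1) ^ (2 * s) := Real.rpow_nonneg (hj _) _
    simp only [trigModeEquiv, TrigMode.freq, Equiv.coe_fn_mk]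
    rw [← ENNReal.ofReal_add (by positivity) (by positivity), ← mul_add, ← key]

/-- Square of the norm of `ℋ^s = H^s × H^{s-1}`. -/
def pairSobolevSq (s : ℝ) (u₀ u₁ : RealSeries) : ℝ≥0∞ :=
  sobolevSq s u₀ + sobolevSq (s - 1) u₁

/-- `(u₀, u₁) ∈ ℋ^s = H^s × H^{s-1}`. -/
def MemPairSobolev (s : ℝ) (u₀ u₁ : RealSeries) : Prop :=
  sobolevSq s u₀ < ∞ ∧ sobolevSq (s - 1) u₁ < ∞

/-- The Fourier multiplier `φ(|∇|)`, where `|∇| = √(-Δ)`. -/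
def multiplier (φ : ℝ → ℝ) (u : RealSeries) : RealSeries := fun m => φ (freqNorm m.freq) * u m

/-- The free wave propagator
`S(t)(u₀, u₁) = cos(t√(-Δ)) u₀ + (sin(t√(-Δ)) / √(-Δ)) u₁`; the symbol `sin(tρ) / ρ` has the value
`t` at `ρ = 0`. -/
def waveS (t : ℝ) (u₀ u₁ : RealSeries) : RealSeries :=
  multiplier (fun ρ => Real.cos (t * ρ)) u₀
    + multiplier (fun ρ => if ρ = 0 then t else Real.sin (t * ρ) / ρ) u₁

/-- `S̃(t)(u₀, u₁) = -(|∇| / ⟨∇⟩) sin(t|∇|) u₀ + (cos(t|∇|) / ⟨∇⟩) u₁`. -/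
def waveSTilde (t : ℝ) (u₀ u₁ : RealSeries) : RealSeries :=
  multiplier (fun ρ => -(ρ / japanese ρ * Real.sin (t * ρ))) u₀
    + multiplier (fun ρ => Real.cos (t * ρ) / japanese ρ) u₁

/-- The integrable function `f` on `𝕋³` is the sum of the series `u` in the sense of distributions:
its Fourier coefficients are those of `u`. -/
def Represents (f : T3 → ℝ) (u : RealSeries) : Prop :=
  Integrable f ∧ ∀ n : Z3,
    (1 / (2 * Real.pi) ^ 3 : ℂ) * ∫ x, character (-n) x * (f x : ℂ) = fourierCoefficient u n

/-- The norm in `L^r(𝕋³)`, `1 ≤ r ≤ ∞`, of the distribution with Fourier series `u`: the `L^r` norm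
of the (almost everywhere unique) integrable function with this Fourier series, and `∞` if there is
none. -/
def spaceNorm (r : ℝ≥0∞) (u : RealSeries) : ℝ≥0∞ :=
  ⨅ (f : T3 → ℝ) (_ : Represents f u), eLpNorm f r volume

/-- The norm in `L^∞_t L^r_x([0,T] × 𝕋³)` of `t ↦ w t`. -/
def spaceTimeNorm (T : ℝ) (r : ℝ≥0∞) (w : ℝ → RealSeries) : ℝ≥0∞ :=
  essSup (fun t => spaceNorm r (w t)) (volume.restrict (Set.Icc 0 T))

/-- `g j const = α_j`, `g j (cosine n) = β_{n,j}`, `g j (sine n) = γ_{n,j}` are independent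
identically distributed real random variables on `(Ω, P)` with law `θ`, and
`∫ e^{γx} dθ(x) ≤ e^{Kγ²}` for every real `γ`. -/
structure IsRandomizer {Ω : Type*} [MeasurableSpace Ω] (P : Measure Ω) (θ : Measure ℝ) (K : ℝ)
    (g : Fin 2 → TrigMode → Ω → ℝ) : Prop where
  measurable : ∀ j m, Measurable (g j m)
  indep : iIndepFun (fun (p : Fin 2 × TrigMode) => g p.1 p.2) P
  law : ∀ j m, P.map (g j m) = θ
  subgaussian : ∀ γ : ℝ, Integrable (fun x => Real.exp (γ * x)) θ ∧
    ∫ x, Real.exp (γ * x) ∂θ ≤ Real.exp (K * γ ^ 2)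

/-- The randomized series
`α_j a_j + ∑_{n ≠ 0} (β_{n,j} b_{n,j} cos(n·x) + γ_{n,j} c_{n,j} sin(n·x))` at the sample `ω`, where
`g` is the family of random variables with the fixed index `j`. -/
def randomize {Ω : Type*} (g : TrigMode → Ω → ℝ) (u : RealSeries) (ω : Ω) : RealSeries :=
  fun m => g m ω * u m

/-- `exp (-(a / b))` for `a, b ∈ [0, ∞]`, with `a / 0 = ∞` for `a ≠ 0`, `a / ∞ = 0` for finite `a`,
and `exp (-∞) = 0`. -/
def expNegDiv (a b : ℝ≥0∞) : ℝ≥0∞ := EReal.exp (-((a / b : ℝ≥0∞) : EReal))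

end RandomWave

end

namespace RandomWave

theorem character_apply_add (m n : Z3) (x : T3) :
    character (m + n) x = character m x * character n x := by
  simp [character, Finset.prod_mul_distrib]

theorem character_neg (n : Z3) (x : T3) :
    character (-n) x = (starRingEnd ℂ) (character n x) := by
  simp [character, map_prod]

theorem norm_character (n : Z3) (x : T3) : ‖character n x‖ = 1 := by
  rw [character, norm_prod]
  exact Finset.prod_eq_one fun i _ => by rw [fourier_apply]; exact Circle.norm_coe _

theorem continuous_character (n : Z3) : Continuous (character n) := by
  unfold character
  fun_prop

theorem integral_fourier_addCircle (n : ℤ) :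
    ∫ x : AddCircle (2 * Real.pi), fourier n x = if n = 0 then ((2 * Real.pi : ℝ) : ℂ) else 0 := by
  have h := congrFun (fourierCoeff_fourier (T := 2 * Real.pi) n) 0
  rw [fourierCoeff] at h
  simp only [neg_zero, fourier_zero, one_smul] at h
  rw [AddCircle.integral_haarAddCircle] at h
  have hpi : (2 * Real.pi : ℝ) ≠ 0 := by positivity
  rw [inv_smul_eq_iff₀ hpi] at h
  rw [h]
  by_cases hn : n = 0
  · subst hn; simp
  · rw [if_neg hn, Pi.single_eq_of_ne (Ne.symm hn), smul_zero]

theorem integral_character (n : Z3) :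
    (1 / (2 * Real.pi) ^ 3 : ℂ) * ∫ x, character n x = if n = 0 then 1 else 0 := by
  unfold character
  rw [integral_fintype_prod_volume_eq_prod (fun i (x : AddCircle (2 * Real.pi)) => fourier (n i) x)]
  simp_rw [integral_fourier_addCircle]
  by_cases hn : n = 0
  · subst hn
    have hpi : (Real.pi : ℂ) ≠ 0 := by exact_mod_cast Real.pi_ne_zero
    simp [hpi]
  · rw [if_neg hn]
    obtain ⟨i, hi⟩ := Function.ne_iff.1 hn
    rw [Finset.prod_eq_zero (Finset.mem_univ i) (if_neg hi), mul_zero]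

/-- The function `1`, `cos(n·x)` or `sin(n·x)` of a term of a real Fourier series. -/
noncomputable def modeFun : TrigMode → T3 → ℝ
  | .const, _ => 1
  | .cosine n, x => (character n.1 x).re
  | .sine n, x => (character n.1 x).im

theorem continuous_modeFun (m : TrigMode) : Continuous (modeFun m) := by
  cases m with
  | const => exact continuous_const
  | cosine n => exact Complex.continuous_re.comp (continuous_character _)
  | sine n => exact Complex.continuous_im.comp (continuous_character _)

theorem abs_modeFun_le (m : TrigMode) (x : T3) : |modeFun m x| ≤ 1 := by
  cases m with
  | const => simp [modeFun]
  | cosine n => exact (Complex.abs_re_le_norm _).trans (norm_character _ _).le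
  | sine n => exact (Complex.abs_im_le_norm _).trans (norm_character _ _).le

theorem abs_modeFun_sub_le (m : TrigMode) (x y : T3) :
    |modeFun m x - modeFun m y| ≤ ‖character m.freq x - character m.freq y‖ := by
  cases m with
  | const => simp [modeFun]
  | cosine n =>
    simp only [modeFun, ← Complex.sub_re]
    exact Complex.abs_re_le_norm _
  | sine n =>
    simp only [modeFun, ← Complex.sub_im]
    exact Complex.abs_im_le_norm _

open Classical in
/-- The series with the single coefficient `1`, at `m`. -/
noncomputable def unitSeries (m : TrigMode) : RealSeries := Pi.single m 1

theorem fourierCoefficient_add (u v : RealSeries) (n : Z3) :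
    fourierCoefficient (u + v) n = fourierCoefficient u n + fourierCoefficient v n := by
  unfold fourierCoefficient cosCoeff sinCoeff
  by_cases hn : n = 0
  · simp [hn]
  · simp [hn]
    ring

theorem fourierCoefficient_smul (c : ℝ) (u : RealSeries) (n : Z3) :
    fourierCoefficient (c • u) n = c * fourierCoefficient u n := by
  unfold fourierCoefficient cosCoeff sinCoeff
  by_cases hn : n = 0
  · simp [hn]
  · simp [hn]
    ring

theorem fourierCoefficient_zero (n : Z3) : fourierCoefficient 0 n = 0 := by
  simpa using fourierCoefficient_smul 0 0 n

theorem Represents.add {f g : T3 → ℝ} {u v : RealSeries} (hf : Represents f u)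
    (hg : Represents g v) : Represents (f + g) (u + v) := by
  refine ⟨hf.1.add hg.1, fun n => ?_⟩
  have key : ∀ h : T3 → ℝ, Integrable h →
      Integrable (fun x => character (-n) x * (h x : ℂ)) := fun h hh =>
    hh.ofReal.bdd_mul (c := 1) (continuous_character _).aestronglyMeasurable
      (ae_of_all _ fun x => (norm_character _ _).le)
  rw [fourierCoefficient_add, ← hf.2, ← hg.2, ← mul_add, ← integral_add (key f hf.1) (key g hg.1)]
  congr 2
  funext x
  simp [mul_add]

theorem Represents.smul {f : T3 → ℝ} {u : RealSeries} (hf : Represents f u) (c : ℝ) :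
    Represents (c • f) (c • u) := by
  refine ⟨hf.1.smul c, fun n => ?_⟩
  rw [fourierCoefficient_smul, ← hf.2, mul_left_comm, ← integral_const_mul (c : ℂ)]
  congr 2
  funext x
  simp [mul_left_comm]

theorem represents_zero : Represents 0 0 :=
  ⟨integrable_zero _ _ _, fun n => by simp [fourierCoefficient_zero]⟩

theorem represents_sum {ι : Type*} (s : Finset ι) (f : ι → T3 → ℝ) (u : ι → RealSeries)
    (h : ∀ i ∈ s, Represents (f i) (u i)) : Represents (∑ i ∈ s, f i) (∑ i ∈ s, u i) := by
  classical
  induction s using Finset.induction_on with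
  | empty => simpa using represents_zero
  | insert i s his ih =>
    rw [Finset.sum_insert his, Finset.sum_insert his]
    exact (h i (Finset.mem_insert_self _ _)).add
      (ih fun j hj => h j (Finset.mem_insert_of_mem hj))

theorem integrable_of_continuous {E : Type*} [NormedAddCommGroup E] {f : T3 → E}
    (hf : Continuous f) : Integrable f :=
  hf.integrable_of_hasCompactSupport (HasCompactSupport.of_compactSpace f)

theorem represents_modeFun (m : TrigMode) : Represents (modeFun m) (unitSeries m) := by
  refine ⟨integrable_of_continuous (continuous_modeFun m), fun n => ?_⟩
  cases m with
  | const =>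
    simp only [modeFun, Complex.ofReal_one, mul_one]
    rw [integral_character]
    by_cases hn : n = 0
    · simp [hn, fourierCoefficient, unitSeries]
    · simp [hn, fourierCoefficient, unitSeries, cosCoeff, sinCoeff]
  | cosine p =>
    have h : ∀ x, character (-n) x * (modeFun (.cosine p) x : ℂ)
        = (1 / 2 : ℂ) * character (p.1 - n) x + (1 / 2 : ℂ) * character (-p.1 - n) x := by
      intro x
      rw [sub_eq_add_neg, sub_eq_add_neg, character_apply_add, character_apply_add,
        character_neg p.1, modeFun, Complex.re_eq_add_conj]
      ring
    simp_rw [h]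
    rw [integral_add, integral_const_mul, integral_const_mul, mul_add, mul_left_comm,
      integral_character, mul_left_comm, integral_character]
    · have h1 : p.1 - n = 0 ↔ n = p.1 := by rw [sub_eq_zero, eq_comm]
      have h2 : -p.1 - n = 0 ↔ -n = p.1 := by
        rw [sub_eq_zero]; constructor <;> intro h <;> rw [← h, neg_neg]
      simp only [h1, h2]
      by_cases hn : n = 0
      · have : (0 : Z3) ≠ p.1 := p.2.symm
        simp [hn, fourierCoefficient, unitSeries, this]
      · simp only [fourierCoefficient, unitSeries, cosCoeff, sinCoeff, hn, Pi.single_apply,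
          Subtype.ext_iff, TrigMode.cosine.injEq, neg_eq_zero, ne_eq, not_false_eq_true, dif_pos,
          if_false, reduceCtorEq]
        split_ifs <;> push_cast <;> ring
    · exact (integrable_of_continuous (continuous_character _)).const_mul _
    · exact (integrable_of_continuous (continuous_character _)).const_mul _
  | sine p =>
    have h : ∀ x, character (-n) x * (modeFun (.sine p) x : ℂ)
        = (1 / (2 * Complex.I) : ℂ) * character (p.1 - n) x
          - (1 / (2 * Complex.I) : ℂ) * character (-p.1 - n) x := by
      intro x
      rw [sub_eq_add_neg p.1, sub_eq_add_neg (-p.1), character_apply_add, character_apply_add,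
        character_neg p.1, modeFun, Complex.im_eq_sub_conj]
      ring
    simp_rw [h]
    rw [integral_sub, integral_const_mul, integral_const_mul, mul_sub, mul_left_comm,
      integral_character, mul_left_comm, integral_character]
    · have h1 : p.1 - n = 0 ↔ n = p.1 := by rw [sub_eq_zero, eq_comm]
      have h2 : -p.1 - n = 0 ↔ -n = p.1 := by
        rw [sub_eq_zero]; constructor <;> intro h <;> rw [← h, neg_neg]
      simp only [h1, h2]
      by_cases hn : n = 0
      · have : (0 : Z3) ≠ p.1 := p.2.symm
        simp [hn, fourierCoefficient, unitSeries, this]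
      · simp only [fourierCoefficient, unitSeries, cosCoeff, sinCoeff, hn, Pi.single_apply,
          Subtype.ext_iff, TrigMode.sine.injEq, neg_eq_zero, ne_eq, not_false_eq_true, dif_pos,
          if_false, reduceCtorEq]
        have hI : (1 / (2 * Complex.I) : ℂ) = -Complex.I / 2 := by
          rw [one_div, mul_inv, Complex.inv_I]; ring
        rw [hI]
        split_ifs <;> push_cast <;> ring
    · exact (integrable_of_continuous (continuous_character _)).const_mul _
    · exact (integrable_of_continuous (continuous_character _)).const_mul _

/-- A uniformly convergent series of continuous functions represents the series whose Fourier
coefficients are the sums of those of the terms. -/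
theorem represents_tsum {F : ℕ → T3 → ℝ} {w : ℕ → RealSeries} {u : RealSeries} {b : ℕ → ℝ}
    (hc : ∀ k, Continuous (F k)) (hb : ∀ k x, |F k x| ≤ b k) (hs : Summable b)
    (hF : ∀ k, Represents (F k) (w k))
    (hu : ∀ n, HasSum (fun k => fourierCoefficient (w k) n) (fourierCoefficient u n)) :
    Represents (fun x => ∑' k, F k x) u := by
  have hcont : Continuous fun x => ∑' k, F k x := continuous_tsum hc hs hb
  refine ⟨integrable_of_continuous hcont, fun n => ?_⟩
  have hsum : ∀ x, Summable fun k => F k x := fun x =>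
    Summable.of_norm_bounded hs fun k => hb k x
  have h := hasSum_integral_of_dominated_convergence (μ := (volume : Measure T3))
    (F := fun k x => character (-n) x * (F k x : ℂ))
    (f := fun x => character (-n) x * ((∑' k, F k x : ℝ) : ℂ)) (fun k _ => b k)
    (fun k => ((continuous_character _).mul
      (Complex.continuous_ofReal.comp (hc k))).aestronglyMeasurable)
    (fun k => ae_of_all _ fun x => by
      rw [norm_mul, norm_character, one_mul, Complex.norm_real]; exact hb k x)
    (ae_of_all _ fun _ => hs) (integrable_const _)
    (ae_of_all _ fun x => by
      have := (hsum x).hasSum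
      exact (Complex.hasSum_ofReal.2 this).mul_left _)
  have h' := h.mul_left (1 / (2 * Real.pi) ^ 3 : ℂ)
  simp_rw [fun k => (hF k).2 n] at h'
  exact h'.unique (hu n)

theorem spaceNorm_le_of_abs_le {f : T3 → ℝ} {u : RealSeries} (hf : Represents f u) {A : ℝ}
    (hA : ∀ x, |f x| ≤ A) {r : ℝ≥0∞} (hr : 2 ≤ r) :
    spaceNorm r u ≤ ENNReal.ofReal ((1 + (2 * Real.pi) ^ 3) * A) := by
  refine (iInf₂_le f hf).trans ((eLpNorm_le_of_ae_bound (ae_of_all _ hA)).trans ?_)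
  rw [ENNReal.ofReal_mul (by positivity)]
  gcongr
  have hv : (volume : Measure T3) Set.univ = ENNReal.ofReal ((2 * Real.pi) ^ 3) := by
    rw [← Set.pi_univ Set.univ, volume_pi_pi]
    simp [AddCircle.measure_univ, ENNReal.ofReal_pow Real.two_pi_pos.le]
  rw [hv]
  have h1 : (1 : ℝ≥0∞) ≤ ENNReal.ofReal (1 + (2 * Real.pi) ^ 3) := by
    rw [← ENNReal.ofReal_one]
    exact ENNReal.ofReal_le_ofReal (le_add_of_nonneg_right (by positivity))
  have he : r.toReal⁻¹ ≤ 1 := by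
    rcases eq_or_ne r ∞ with rfl | h
    · simp
    · apply inv_le_one_of_one_le₀
      have := ENNReal.toReal_mono h hr
      simp at this
      linarith
  calc ENNReal.ofReal ((2 * Real.pi) ^ 3) ^ r.toReal⁻¹
      ≤ ENNReal.ofReal (1 + (2 * Real.pi) ^ 3) ^ r.toReal⁻¹ := by
        gcongr
        linarith
    _ ≤ ENNReal.ofReal (1 + (2 * Real.pi) ^ 3) ^ (1 : ℝ) :=
        ENNReal.rpow_le_rpow_of_exponent_le h1 he
    _ = _ := ENNReal.rpow_one _

/-- The dyadic level of a frequency: `⌊log₂ max |nᵢ|⌋`, and `0` for `n = 0`. -/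
def level (n : Z3) : ℕ := Nat.log 2 (Finset.univ.sup fun i => (n i).natAbs)

theorem level_neg (n : Z3) : level (-n) = level n := by simp [level]

theorem natAbs_lt_two_pow_level (n : Z3) (i : Fin 3) : (n i).natAbs < 2 ^ (level n + 1) :=
  (Finset.le_sup (f := fun i => (n i).natAbs) (Finset.mem_univ i)).trans_lt
    (Nat.lt_pow_succ_log_self one_lt_two _)

theorem one_le_japanese (ρ : ℝ) : 1 ≤ japanese ρ := by
  rw [japanese, Real.one_le_sqrt]
  nlinarith [sq_nonneg ρ]

theorem japanese_pos (ρ : ℝ) : 0 < japanese ρ := zero_lt_one.trans_le (one_le_japanese ρ)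

theorem le_japanese (ρ : ℝ) : ρ ≤ japanese ρ := Real.le_sqrt_of_sq_le (by linarith)

theorem abs_le_freqNorm (n : Z3) (i : Fin 3) : |(n i : ℝ)| ≤ freqNorm n := by
  refine Real.le_sqrt_of_sq_le ?_
  rw [sq_abs]
  exact Finset.single_le_sum (f := fun i => (n i : ℝ) ^ 2) (fun i _ => sq_nonneg _)
    (Finset.mem_univ i)

theorem freqNorm_eq_zero_or_one_le (n : Z3) : freqNorm n = 0 ∨ 1 ≤ freqNorm n := by
  rcases eq_or_ne n 0 with rfl | hn
  · left; simp [freqNorm]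
  · right
    obtain ⟨i, hi⟩ := Function.ne_iff.1 hn
    refine le_trans ?_ (abs_le_freqNorm n i)
    exact_mod_cast Int.one_le_abs hi

theorem two_pow_level_le_japanese (n : Z3) : (2 : ℝ) ^ level n ≤ japanese (freqNorm n) := by
  by_cases h : (Finset.univ.sup fun i => (n i).natAbs) = 0
  · simp [level, h, one_le_japanese]
  · obtain ⟨i, -, hi⟩ := Finset.exists_mem_eq_sup Finset.univ Finset.univ_nonempty
      fun i => (n i).natAbs
    have h1 : 2 ^ level n ≤ (n i).natAbs := hi ▸ Nat.pow_log_le_self 2 h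
    have h2 : (2 : ℝ) ^ level n ≤ ((n i).natAbs : ℝ) := by exact_mod_cast h1
    rw [Nat.cast_natAbs, Int.cast_abs] at h2
    exact h2.trans ((abs_le_freqNorm n i).trans (le_japanese _))

theorem japanese_le_two_pow_level (n : Z3) : japanese (freqNorm n) ≤ 4 * 2 ^ level n := by
  have h : ∀ i, (n i : ℝ) ^ 2 ≤ 4 * (2 ^ level n) ^ 2 := by
    intro i
    have h1 : (((n i).natAbs : ℕ) : ℝ) ≤ 2 ^ (level n + 1) := by
      exact_mod_cast (natAbs_lt_two_pow_level n i).le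
    rw [Nat.cast_natAbs, Int.cast_abs, pow_succ] at h1
    rw [← sq_abs]
    nlinarith [abs_nonneg (n i : ℝ)]
  have h2 : (1 : ℝ) ≤ 2 ^ level n := one_le_pow₀ one_le_two
  rw [japanese, freqNorm, Real.sq_sqrt (by positivity), Fin.sum_univ_three]
  refine Real.sqrt_le_iff.2 ⟨by positivity, ?_⟩
  nlinarith [h 0, h 1, h 2]

theorem finite_setOf_level_eq (k : ℕ) : {m : TrigMode | level m.freq = k}.Finite ∧
    {m : TrigMode | level m.freq = k}.ncard ≤ 3 * (2 ^ (k + 3)) ^ 3 := by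
  classical
  let box : Finset Z3 := Fintype.piFinset fun _ => Finset.Icc (-2 ^ (k + 1) : ℤ) (2 ^ (k + 1))
  let kind : TrigMode → Fin 3 := fun m => match m with
    | .const => 0
    | .cosine _ => 1
    | .sine _ => 2
  let f : TrigMode → Fin 3 × Z3 := fun m => (kind m, m.freq)
  have hf : Function.Injective f := by
    rintro (_ | n | n) (_ | n' | n') h <;> simp_all [f, kind, TrigMode.freq, Subtype.ext_iff]
  have hmaps : Set.MapsTo f {m : TrigMode | level m.freq = k}
      (↑((Finset.univ : Finset (Fin 3)) ×ˢ box) : Set (Fin 3 × Z3)) := by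
    intro m hm
    simp only [Finset.coe_product, Finset.coe_univ, Set.mem_prod, Set.mem_univ, true_and,
      Finset.mem_coe, box, Fintype.mem_piFinset, Finset.mem_Icc, f]
    intro i
    have := natAbs_lt_two_pow_level m.freq i
    rw [hm] at this
    have h2 : ((m.freq i).natAbs : ℤ) < 2 ^ (k + 1) := by exact_mod_cast this
    omega
  refine ⟨Set.Finite.of_injOn hmaps hf.injOn (Finset.finite_toSet _), ?_⟩
  refine (Set.ncard_le_ncard_of_injOn f hmaps hf.injOn (Finset.finite_toSet _)).trans ?_
  rw [Set.ncard_coe_finset, Finset.card_product, Finset.card_univ, Fintype.card_fin,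
    Fintype.card_piFinset]
  simp only [Int.card_Icc, Finset.prod_const, Finset.card_univ, Fintype.card_fin]
  gcongr
  have h1 : (1 : ℤ) ≤ 2 ^ k := one_le_pow₀ (by norm_num)
  have h2 : (2 : ℤ) ^ (k + 1) = 2 * 2 ^ k := by ring
  have h3 : (2 : ℤ) ^ (k + 3) = 8 * 2 ^ k := by ring
  zify
  rw [Int.toNat_of_nonneg] <;> omega

/-- The terms whose frequency has dyadic level `k`. -/
noncomputable def block (k : ℕ) : Finset TrigMode := (finite_setOf_level_eq k).1.toFinset

theorem mem_block {k : ℕ} {m : TrigMode} : m ∈ block k ↔ level m.freq = k := by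
  simp [block]

theorem card_block_le (k : ℕ) : (block k).card ≤ 3 * (2 ^ (k + 3)) ^ 3 := by
  rw [block, ← Set.ncard_eq_toFinset_card _ (finite_setOf_level_eq k).1]
  exact (finite_setOf_level_eq k).2

theorem card_univ_product_block_le (k : ℕ) :
    ((Finset.univ : Finset (Fin 2)) ×ˢ block k).card ≤ 3072 * 8 ^ k := by
  rw [Finset.card_product, Finset.card_univ, Fintype.card_fin]
  refine (Nat.mul_le_mul_left 2 (card_block_le k)).trans_eq ?_
  rw [show (8 : ℕ) = 2 ^ 3 by norm_num, ← pow_mul, ← pow_mul, add_mul, pow_add, mul_comm 3 k]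
  ring

theorem sum_block_smul_unitSeries_apply (k : ℕ) (w : RealSeries) (m : TrigMode) :
    (∑ m ∈ block k, w m • unitSeries m) m = if level m.freq = k then w m else 0 := by
  classical
  simp [unitSeries, Finset.sum_apply, Pi.single_apply, mem_block]

theorem hasSum_fourierCoefficient_block (w : RealSeries) (n : Z3) :
    HasSum (fun k => fourierCoefficient (∑ m ∈ block k, w m • unitSeries m) n)
      (fourierCoefficient w n) := by
  have key : ∀ k, fourierCoefficient (∑ m ∈ block k, w m • unitSeries m) n
      = if k = level n then fourierCoefficient w n else 0 := by
    intro k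
    unfold fourierCoefficient cosCoeff sinCoeff
    simp only [sum_block_smul_unitSeries_apply, TrigMode.freq, level_neg]
    by_cases hn : n = 0
    · subst hn
      by_cases hk : level 0 = k
      · simp [hk]
      · simp [hk, Ne.symm hk]
    · by_cases hk : level n = k
      · simp [hn, hk]
      · simp [hn, hk, Ne.symm hk]
  simp_rw [key]
  exact hasSum_ite_eq _ _

theorem hasSubgaussianMGF_mono {Ω : Type*} [MeasurableSpace Ω] {P : Measure Ω} {X : Ω → ℝ}
    {c d : NNReal} (h : HasSubgaussianMGF X c P) (hcd : c ≤ d) : HasSubgaussianMGF X d P where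
  integrable_exp_mul := h.integrable_exp_mul
  mgf_le t := (h.mgf_le t).trans (by gcongr)

section

variable {Ω : Type*} [MeasurableSpace Ω] {P : Measure Ω} {θ : Measure ℝ} {K : ℝ}
  {g : Fin 2 → TrigMode → Ω → ℝ}

theorem IsRandomizer.hasSubgaussianMGF (h : IsRandomizer P θ K g) (hK : 0 < K) (j : Fin 2)
    (m : TrigMode) : HasSubgaussianMGF (g j m) (2 * K).toNNReal P := by
  have hg := (h.measurable j m).aemeasurable (μ := P)
  rw [← HasSubgaussianMGF.id_map_iff hg, h.law j m]
  refine ⟨fun t => (h.subgaussian t).1, fun t => (h.subgaussian t).2.trans_eq ?_⟩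
  rw [Real.coe_toNNReal _ (by positivity)]
  congr 1
  ring

/-- The sub-Gaussian tail of a finite linear combination of the random variables. -/
theorem IsRandomizer.measure_abs_sum_gt_le (h : IsRandomizer P θ K g) (hK : 0 < K)
    (s : Finset (Fin 2 × TrigMode)) (a : Fin 2 × TrigMode → ℝ) {A y : ℝ} (hA : 0 < A)
    (ha : ∑ p ∈ s, a p ^ 2 ≤ A ^ 2) (hy : 0 ≤ y) :
    P {ω | A * y < |∑ p ∈ s, a p * g p.1 p.2 ω|}
      ≤ ENNReal.ofReal (2 * Real.exp (-(y ^ 2 / (4 * K)))) := by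
  have := h.indep.isProbabilityMeasure
  have hind : iIndepFun (fun p ω => a p * g p.1 p.2 ω) P :=
    h.indep.comp (fun p x => a p * x) fun p => measurable_const_mul _
  have h1 := HasSubgaussianMGF.sum_of_iIndepFun hind (s := s)
    (c := fun p => NNReal.mk (a p ^ 2) (sq_nonneg _) * (2 * K).toNNReal)
    fun p _ => (h.hasSubgaussianMGF hK p.1 p.2).const_mul (a p)
  have h2 : HasSubgaussianMGF (fun ω => ∑ p ∈ s, a p * g p.1 p.2 ω)
      (A ^ 2 * (2 * K)).toNNReal P := by
    refine hasSubgaussianMGF_mono h1 ?_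
    rw [← NNReal.coe_le_coe, Real.coe_toNNReal _ (by positivity), ← Finset.sum_mul]
    push_cast
    rw [Real.coe_toNNReal _ (by positivity)]
    gcongr
  have he : -(A * y) ^ 2 / (2 * ((A ^ 2 * (2 * K)).toNNReal : ℝ)) = -(y ^ 2 / (4 * K)) := by
    rw [Real.coe_toNNReal _ (by positivity)]
    field_simp
    ring
  have h3 := h2.measure_ge_le (mul_nonneg hA.le hy)
  have h4 := h2.neg.measure_ge_le (mul_nonneg hA.le hy)
  rw [he] at h3 h4
  have hsub : {ω | A * y < |∑ p ∈ s, a p * g p.1 p.2 ω|}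
      ⊆ {ω | A * y ≤ ∑ p ∈ s, a p * g p.1 p.2 ω}
        ∪ {ω | A * y ≤ (-fun ω => ∑ p ∈ s, a p * g p.1 p.2 ω) ω} := by
    intro ω hω
    rcases lt_abs.1 (Set.mem_ofPred_eq ▸ hω) with h | h
    · exact Or.inl h.le
    · exact Or.inr h.le
  refine (measure_mono hsub).trans ((measure_union_le _ _).trans ?_)
  rw [two_mul, ENNReal.ofReal_add (by positivity) (by positivity)]
  rw [← ENNReal.ofReal_toReal (measure_ne_top P {ω | A * y ≤ ∑ p ∈ s, a p * g p.1 p.2 ω}),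
    ← ENNReal.ofReal_toReal (measure_ne_top P
      {ω | A * y ≤ (-fun ω => ∑ p ∈ s, a p * g p.1 p.2 ω) ω})]
  exact add_le_add (ENNReal.ofReal_le_ofReal h3) (ENNReal.ofReal_le_ofReal h4)

theorem IsRandomizer.measure_abs_gt_le (h : IsRandomizer P θ K g) (hK : 0 < K)
    (p : Fin 2 × TrigMode) {y : ℝ} (hy : 0 ≤ y) :
    P {ω | y < |g p.1 p.2 ω|} ≤ ENNReal.ofReal (2 * Real.exp (-(y ^ 2 / (4 * K)))) := by
  simpa using h.measure_abs_sum_gt_le hK {p} (fun _ => 1) one_pos (by simp) hy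

end

/-- The symbols `φ 0 t` and `φ 1 t` of a propagator satisfy the bounds and the Lipschitz bounds in
`t ∈ [0, T]` of the wave propagators. -/
structure IsWaveSymbol (T : ℝ) (φ : Fin 2 → ℝ → ℝ → ℝ) : Prop where
  bound : ∀ j, ∀ t ∈ Set.Icc 0 T, ∀ ρ, (ρ = 0 ∨ 1 ≤ ρ) →
    |φ j t ρ| * japanese ρ ^ (j : ℕ) ≤ 2 * max 1 T
  lipschitz : ∀ j t t' ρ, (ρ = 0 ∨ 1 ≤ ρ) →
    |φ j t ρ - φ j t' ρ| * japanese ρ ^ (j : ℕ) ≤ japanese ρ * |t - t'|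

theorem isWaveSymbol_waveS (T : ℝ) : IsWaveSymbol T fun j t ρ =>
    if j = 0 then Real.cos (t * ρ) else if ρ = 0 then t else Real.sin (t * ρ) / ρ where
  bound j t ht ρ hρ := by
    have hB : (1 : ℝ) ≤ max 1 T := le_max_left _ _
    fin_cases j
    · have := Real.abs_cos_le_one (t * ρ)
      simp
      linarith
    · rcases hρ with rfl | hρ
      · have : T ≤ max 1 T := le_max_right _ _
        have h0 := ht.1
        simp [japanese, abs_of_nonneg ht.1]
        linarith [ht.2]
      · have h0 : 0 < ρ := by linarith
        have hj : japanese ρ ≤ 2 * ρ := by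
          refine Real.sqrt_le_iff.2 ⟨by positivity, by nlinarith⟩
        have hs := Real.abs_sin_le_one (t * ρ)
        simp [h0.ne', abs_div, abs_of_pos h0]
        rw [div_mul_eq_mul_div, div_le_iff₀ h0]
        nlinarith [abs_nonneg (Real.sin (t * ρ)), japanese_pos ρ]
  lipschitz j t t' ρ hρ := by
    have h0 : 0 ≤ ρ := by rcases hρ with rfl | h <;> linarith
    have he : |t * ρ - t' * ρ| = ρ * |t - t'| := by
      rw [← sub_mul, abs_mul, abs_of_nonneg h0, mul_comm]
    fin_cases j
    · have := Real.abs_cos_sub_cos_le (t * ρ) (t' * ρ)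
      simp
      refine this.trans ?_
      rw [he]
      gcongr
      exact le_japanese ρ
    · rcases hρ with rfl | hρ
      · simp [japanese]
      · have h1 : 0 < ρ := by linarith
        have := Real.abs_sin_sub_sin_le (t * ρ) (t' * ρ)
        simp only [Fin.mk_one, one_ne_zero, if_false, h1.ne', ← sub_div, abs_div, abs_of_pos h1,
          pow_one]
        rw [mul_comm (japanese ρ)]
        refine mul_le_mul_of_nonneg_right ?_ (japanese_pos ρ).le
        rw [div_le_iff₀ h1]
        linarith

theorem isWaveSymbol_waveSTilde (T : ℝ) : IsWaveSymbol T fun j t ρ =>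
    if j = 0 then -(ρ / japanese ρ * Real.sin (t * ρ)) else Real.cos (t * ρ) / japanese ρ where
  bound j t ht ρ hρ := by
    have hB : (1 : ℝ) ≤ max 1 T := le_max_left _ _
    have h0 : 0 ≤ ρ := by rcases hρ with rfl | h <;> linarith
    have hj := japanese_pos ρ
    fin_cases j
    · have h1 := Real.abs_sin_le_one (t * ρ)
      have h2 : ρ / japanese ρ ≤ 1 := div_le_one_of_le₀ (le_japanese ρ) hj.le
      simp [abs_mul, abs_div, abs_of_pos hj, abs_of_nonneg h0]
      have : ρ / japanese ρ * |Real.sin (t * ρ)| ≤ 1 * 1 :=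
        mul_le_mul h2 h1 (abs_nonneg _) zero_le_one
      linarith
    · have := Real.abs_cos_le_one (t * ρ)
      simp [abs_div, abs_of_pos hj, hj.ne']
      linarith
  lipschitz j t t' ρ hρ := by
    have h0 : 0 ≤ ρ := by rcases hρ with rfl | h <;> linarith
    have hj := japanese_pos ρ
    have he : |t * ρ - t' * ρ| = ρ * |t - t'| := by
      rw [← sub_mul, abs_mul, abs_of_nonneg h0, mul_comm]
    fin_cases j
    · have h1 := Real.abs_sin_sub_sin_le (t' * ρ) (t * ρ)
      rw [abs_sub_comm (t' * ρ), he] at h1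
      have h2 : ρ / japanese ρ ≤ 1 := div_le_one_of_le₀ (le_japanese ρ) hj.le
      simp only [Fin.zero_eta, if_true, pow_zero, mul_one]
      rw [neg_sub_neg, ← mul_sub, abs_mul, abs_div, abs_of_pos hj, abs_of_nonneg h0]
      have := le_japanese ρ
      calc ρ / japanese ρ * |Real.sin (t' * ρ) - Real.sin (t * ρ)|
          ≤ 1 * (ρ * |t - t'|) := mul_le_mul h2 h1 (abs_nonneg _) zero_le_one
        _ ≤ japanese ρ * |t - t'| := by rw [one_mul]; gcongr
    · have h1 := Real.abs_cos_sub_cos_le (t * ρ) (t' * ρ)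
      rw [he] at h1
      simp only [Fin.mk_one, one_ne_zero, if_false, ← sub_div, abs_div, abs_of_pos hj, pow_one]
      rw [div_mul_cancel₀ _ hj.ne']
      refine h1.trans ?_
      gcongr
      exact le_japanese ρ

/-- The contribution of the term `p.2` of the `p.1`-th initial datum to the wave at `(t, x)`. -/
noncomputable def waveTerm (φ : Fin 2 → ℝ → ℝ → ℝ) (u : Fin 2 → RealSeries)
    (p : Fin 2 × TrigMode) (t : ℝ) (x : T3) : ℝ :=
  φ p.1 t (freqNorm p.2.freq) * u p.1 p.2 * modeFun p.2 x

theorem character_coe (n : Z3) (y : Fin 3 → ℝ) :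
    character n (fun i => (y i : AddCircle (2 * Real.pi)))
      = Complex.exp (Complex.I * ((∑ i, n i * y i : ℝ) : ℂ)) := by
  unfold character
  rw [Complex.ofReal_sum, Finset.mul_sum, Complex.exp_sum]
  refine Finset.prod_congr rfl fun i _ => ?_
  rw [fourier_coe_apply]
  congr 1
  have hpi : (Real.pi : ℂ) ≠ 0 := by exact_mod_cast Real.pi_ne_zero
  push_cast
  field_simp

theorem norm_character_coe_sub_le (n : Z3) (y z : Fin 3 → ℝ) :
    ‖character n (fun i => (y i : AddCircle (2 * Real.pi)))
      - character n (fun i => (z i : AddCircle (2 * Real.pi)))‖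
      ≤ ∑ i, |(n i : ℝ)| * |y i - z i| := by
  rw [character_coe, character_coe]
  have h : Complex.exp (Complex.I * ((∑ i, n i * y i : ℝ) : ℂ))
      - Complex.exp (Complex.I * ((∑ i, n i * z i : ℝ) : ℂ))
      = Complex.exp (Complex.I * ((∑ i, n i * z i : ℝ) : ℂ))
        * (Complex.exp (Complex.I * ((∑ i, n i * (y i - z i) : ℝ) : ℂ)) - 1) := by
    rw [mul_sub, ← Complex.exp_add, mul_one]
    congr 2
    push_cast
    rw [← mul_add, ← Finset.sum_add_distrib]
    congr 1
    exact Finset.sum_congr rfl fun i _ => by ring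
  rw [h, norm_mul, Complex.norm_exp_I_mul_ofReal, one_mul]
  refine Real.norm_exp_I_mul_ofReal_sub_one_le.trans ?_
  refine (Finset.abs_sum_le_sum_abs _ _).trans_eq ?_
  simp_rw [abs_mul]

/-- Every point of `[0, L]` is within `L / N` of one of the points `L a / N`. -/
theorem exists_abs_sub_grid_le {L : ℝ} (hL : 0 < L) {N : ℕ} (hN : 0 < N) {s : ℝ}
    (hs : s ∈ Set.Icc 0 L) : ∃ a : Fin (N + 1), |s - L * a / N| ≤ L / N := by
  have hN' : (0 : ℝ) < N := by exact_mod_cast hN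
  have h0 : 0 ≤ s * N / L := by have := hs.1; positivity
  have hle : ⌊s * N / L⌋₊ ≤ N := by
    refine Nat.floor_le_of_le ?_
    rw [div_le_iff₀ hL, mul_comm]
    gcongr
    exact hs.2
  refine ⟨⟨⌊s * N / L⌋₊, Nat.lt_succ_of_le hle⟩, ?_⟩
  have h1 := Nat.floor_le h0
  have h2 := Nat.lt_floor_add_one (s * N / L)
  rw [le_div_iff₀ hL] at h1
  rw [div_lt_iff₀ hL] at h2
  simp only
  have he : s - L * (⌊s * N / L⌋₊ : ℝ) / N = (s * N - ⌊s * N / L⌋₊ * L) / N := by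
    field_simp
  rw [he, abs_div, abs_of_pos hN']
  gcongr
  rw [abs_of_nonneg (by linarith)]
  linarith

/-- The points of the grid in `[0, T] × 𝕋³` used for the frequencies of level `k`. -/
abbrev GridIndex (k : ℕ) : Type := Fin (16 ^ k + 1) × (Fin 3 → Fin (16 ^ k + 1))

/-- The time of a grid point. -/
noncomputable def gridTime (T : ℝ) {k : ℕ} (a : GridIndex k) : ℝ := T * (a.1 : ℕ) / (16 ^ k : ℕ)

/-- The position of a grid point. -/
noncomputable def gridPoint {k : ℕ} (a : GridIndex k) : T3 :=
  fun i => ((2 * Real.pi * (a.2 i : ℕ) / (16 ^ k : ℕ) : ℝ) : AddCircle (2 * Real.pi))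

theorem gridTime_mem {T : ℝ} (hT : 0 < T) {k : ℕ} (a : GridIndex k) :
    gridTime T a ∈ Set.Icc 0 T := by
  refine ⟨by unfold gridTime; positivity, ?_⟩
  have h : ((a.1 : ℕ) : ℝ) ≤ (16 ^ k : ℕ) := by exact_mod_cast Nat.le_of_lt_succ a.1.2
  rw [gridTime, div_le_iff₀ (by positivity)]
  gcongr

theorem exists_grid_near {T : ℝ} (hT : 0 < T) (k : ℕ) {t : ℝ} (ht : t ∈ Set.Icc 0 T) (x : T3) :
    ∃ a : GridIndex k, |t - gridTime T a| ≤ T / 16 ^ k ∧ ∀ n : Z3, level n = k →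
      ‖character n x - character n (gridPoint a)‖ ≤ 48 * 2 ^ k / 16 ^ k := by
  have hN : 0 < 16 ^ k := by positivity
  obtain ⟨a, ha⟩ := exists_abs_sub_grid_le hT hN ht
  have hx : ∀ i, ∃ y ∈ Set.Icc 0 (2 * Real.pi), (y : AddCircle (2 * Real.pi)) = x i := by
    intro i
    obtain ⟨h1, h2⟩ := (AddCircle.equivIco (2 * Real.pi) 0 (x i)).2
    exact ⟨_, ⟨h1, by linarith⟩, AddCircle.coe_equivIco⟩
  choose y hy hyx using hx
  choose b hb using fun i => exists_abs_sub_grid_le Real.two_pi_pos hN (hy i)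
  refine ⟨(a, b), by simpa [gridTime] using ha, fun n hn => ?_⟩
  have hx' : x = fun i => (y i : AddCircle (2 * Real.pi)) := funext fun i => (hyx i).symm
  rw [hx']
  refine (norm_character_coe_sub_le n y fun i => 2 * Real.pi * (b i : ℕ) / (16 ^ k : ℕ)).trans ?_
  have hi : ∀ i, |(n i : ℝ)| * |y i - 2 * Real.pi * (b i : ℕ) / (16 ^ k : ℕ)|
      ≤ 2 * 2 ^ k * (8 / 16 ^ k) := by
    intro i
    have h1 : (((n i).natAbs : ℕ) : ℝ) ≤ 2 ^ (level n + 1) := by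
      exact_mod_cast (natAbs_lt_two_pow_level n i).le
    rw [Nat.cast_natAbs, Int.cast_abs, pow_succ, hn] at h1
    have h2 : |y i - 2 * Real.pi * (b i : ℕ) / (16 ^ k : ℕ)| ≤ 8 / 16 ^ k := by
      refine (hb i).trans ?_
      push_cast
      gcongr
      linarith [Real.pi_le_four]
    exact (mul_le_mul h1 h2 (abs_nonneg _) (by positivity)).trans_eq (by ring)
  refine (Finset.sum_le_sum fun i _ => hi i).trans_eq ?_
  simp
  ring

section

variable {T : ℝ} {φ : Fin 2 → ℝ → ℝ → ℝ} {u : Fin 2 → RealSeries}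

theorem abs_waveTerm_le (hφ : IsWaveSymbol T φ) (p : Fin 2 × TrigMode) {t : ℝ}
    (ht : t ∈ Set.Icc 0 T) (x : T3) :
    |waveTerm φ u p t x|
      ≤ 2 * max 1 T * (|u p.1 p.2| / japanese (freqNorm p.2.freq) ^ (p.1 : ℕ)) := by
  have hj : 0 < japanese (freqNorm p.2.freq) ^ (p.1 : ℕ) := pow_pos (japanese_pos _) _
  rw [waveTerm, abs_mul, abs_mul, ← mul_div_assoc, le_div_iff₀ hj]
  have h1 := hφ.bound p.1 t ht _ (freqNorm_eq_zero_or_one_le p.2.freq)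
  have h2 := abs_modeFun_le p.2 x
  calc |φ p.1 t (freqNorm p.2.freq)| * |u p.1 p.2| * |modeFun p.2 x|
        * japanese (freqNorm p.2.freq) ^ (p.1 : ℕ)
      = |φ p.1 t (freqNorm p.2.freq)| * japanese (freqNorm p.2.freq) ^ (p.1 : ℕ)
        * |u p.1 p.2| * |modeFun p.2 x| := by ring
    _ ≤ 2 * max 1 T * |u p.1 p.2| * 1 := by gcongr
    _ = _ := mul_one _

theorem abs_waveTerm_sub_le (hφ : IsWaveSymbol T φ) (p : Fin 2 × TrigMode) {t t' : ℝ}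
    (ht' : t' ∈ Set.Icc 0 T) (x x' : T3) :
    |waveTerm φ u p t x - waveTerm φ u p t' x'|
      ≤ |u p.1 p.2| / japanese (freqNorm p.2.freq) ^ (p.1 : ℕ)
        * (japanese (freqNorm p.2.freq) * |t - t'|
          + 2 * max 1 T * ‖character p.2.freq x - character p.2.freq x'‖) := by
  have hj : 0 < japanese (freqNorm p.2.freq) ^ (p.1 : ℕ) := pow_pos (japanese_pos _) _
  have hρ := freqNorm_eq_zero_or_one_le p.2.freq
  have h1 := hφ.bound p.1 t' ht' _ hρ
  have h2 := hφ.lipschitz p.1 t t' _ hρ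
  have h3 := abs_modeFun_le p.2 x
  have h4 := abs_modeFun_sub_le p.2 x x'
  set q := japanese (freqNorm p.2.freq) ^ (p.1 : ℕ)
  set ρ := freqNorm p.2.freq
  rw [div_mul_eq_mul_div, le_div_iff₀ hj]
  have he : waveTerm φ u p t x - waveTerm φ u p t' x'
      = u p.1 p.2 * ((φ p.1 t ρ - φ p.1 t' ρ) * modeFun p.2 x
        + φ p.1 t' ρ * (modeFun p.2 x - modeFun p.2 x')) := by
    simp only [waveTerm, ρ]
    ring
  rw [he, abs_mul, mul_assoc]
  gcongr
  calc |(φ p.1 t ρ - φ p.1 t' ρ) * modeFun p.2 x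
        + φ p.1 t' ρ * (modeFun p.2 x - modeFun p.2 x')| * q
      ≤ (|φ p.1 t ρ - φ p.1 t' ρ| * |modeFun p.2 x|
        + |φ p.1 t' ρ| * |modeFun p.2 x - modeFun p.2 x'|) * q := by
        gcongr
        refine (abs_add_le _ _).trans_eq ?_
        rw [abs_mul, abs_mul]
    _ = |φ p.1 t ρ - φ p.1 t' ρ| * q * |modeFun p.2 x|
        + |φ p.1 t' ρ| * q * |modeFun p.2 x - modeFun p.2 x'| := by ring
    _ ≤ japanese ρ * |t - t'| * 1
        + 2 * max 1 T * ‖character p.2.freq x - character p.2.freq x'‖ := by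
        gcongr
        exact mul_nonneg (japanese_pos ρ).le (abs_nonneg _)
    _ = _ := by rw [mul_one]

/-- A block of the wave which is small on the grid is small everywhere. -/
theorem abs_blockSum_le (hT : 0 < T) (hφ : IsWaveSymbol T φ) (k : ℕ) {V y : ℝ} (hy : 0 ≤ y)
    (hV : 0 ≤ V) (γ : Fin 2 × TrigMode → ℝ)
    (hu : ∀ p ∈ Finset.univ ×ˢ block k,
      |u p.1 p.2| / japanese (freqNorm p.2.freq) ^ (p.1 : ℕ) ≤ V)
    (hγ : ∀ p ∈ Finset.univ ×ˢ block k, |γ p| ≤ y)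
    (hgrid : ∀ a : GridIndex k,
      |∑ p ∈ Finset.univ ×ˢ block k, waveTerm φ u p (gridTime T a) (gridPoint a) * γ p|
        ≤ 2 * max 1 T * V * y)
    {t : ℝ} (ht : t ∈ Set.Icc 0 T) (x : T3) :
    |∑ p ∈ Finset.univ ×ˢ block k, waveTerm φ u p t x * γ p| ≤ 400000 * max 1 T * V * y := by
  obtain ⟨a, hat, hax⟩ := exists_grid_near hT k ht x
  have hB : T ≤ max 1 T := le_max_right _ _
  have hB0 : 0 < max 1 T := hT.trans_le hB
  have hterm : ∀ p ∈ (Finset.univ : Finset (Fin 2)) ×ˢ block k,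
      |waveTerm φ u p t x * γ p - waveTerm φ u p (gridTime T a) (gridPoint a) * γ p|
        ≤ V * (100 * max 1 T * (2 ^ k / 16 ^ k)) * y := by
    intro p hp
    have hl : level p.2.freq = k := mem_block.1 (Finset.mem_product.1 hp).2
    rw [← sub_mul, abs_mul]
    have h1 := abs_waveTerm_sub_le (u := u) hφ p (t := t) (gridTime_mem hT a) x (gridPoint a)
    have h2 := hax _ hl
    have h3 := japanese_le_two_pow_level p.2.freq
    rw [hl] at h3
    have h4 := japanese_pos (freqNorm p.2.freq)
    gcongr
    · refine h1.trans ?_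
      refine mul_le_mul (hu p hp) ?_ (by positivity) hV
      calc japanese (freqNorm p.2.freq) * |t - gridTime T a|
            + 2 * max 1 T * ‖character p.2.freq x - character p.2.freq (gridPoint a)‖
          ≤ 4 * 2 ^ k * (max 1 T / 16 ^ k) + 2 * max 1 T * (48 * 2 ^ k / 16 ^ k) := by
            gcongr
            exact hat.trans (by gcongr)
        _ = 100 * max 1 T * (2 ^ k / 16 ^ k) := by ring
    · exact hγ p hp
  have hcard : ((((Finset.univ : Finset (Fin 2)) ×ˢ block k).card : ℕ) : ℝ) ≤ 3072 * 8 ^ k := by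
    exact_mod_cast card_univ_product_block_le k
  have hdiff : |∑ p ∈ Finset.univ ×ˢ block k, waveTerm φ u p t x * γ p
      - ∑ p ∈ Finset.univ ×ˢ block k, waveTerm φ u p (gridTime T a) (gridPoint a) * γ p|
      ≤ 307200 * max 1 T * V * y := by
    rw [← Finset.sum_sub_distrib]
    refine (Finset.abs_sum_le_sum_abs _ _).trans ((Finset.sum_le_sum hterm).trans ?_)
    rw [Finset.sum_const, nsmul_eq_mul]
    have h16 : (16 : ℝ) ^ k = 8 ^ k * 2 ^ k := by rw [← mul_pow]; norm_num
    calc _ ≤ 3072 * 8 ^ k * (V * (100 * max 1 T * (2 ^ k / 16 ^ k)) * y) := by gcongr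
      _ = 307200 * max 1 T * V * y := by rw [h16]; field_simp; ring
  have hg := hgrid a
  have hp : 0 ≤ max 1 T * V * y := by positivity
  have := abs_sub_abs_le_abs_sub (∑ p ∈ Finset.univ ×ˢ block k, waveTerm φ u p t x * γ p)
    (∑ p ∈ Finset.univ ×ˢ block k, waveTerm φ u p (gridTime T a) (gridPoint a) * γ p)
  linarith

end

/-- The coefficient of the term `m` of the wave at time `t` with the symbols `φ 0` and `φ 1`. -/
noncomputable def waveSeries (φ : Fin 2 → ℝ → ℝ → ℝ) (u : Fin 2 → RealSeries) (t : ℝ) : RealSeries :=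
  fun m => ∑ j, φ j t (freqNorm m.freq) * u j m

theorem exists_isWaveSymbol {Sstar : ℝ → RealSeries → RealSeries → RealSeries}
    (h : Sstar = waveS ∨ Sstar = waveSTilde) (T : ℝ) :
    ∃ φ, IsWaveSymbol T φ ∧ ∀ t u₀ u₁, Sstar t u₀ u₁ = waveSeries φ ![u₀, u₁] t := by
  rcases h with rfl | rfl
  · refine ⟨_, isWaveSymbol_waveS T, fun t u₀ u₁ => ?_⟩
    funext m
    simp [waveS, waveSeries, multiplier]
  · refine ⟨_, isWaveSymbol_waveSTilde T, fun t u₀ u₁ => ?_⟩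
    funext m
    simp [waveSTilde, waveSeries, multiplier]

theorem summable_pow_mul_exp_neg {q a β : ℝ} (hq : 0 < q) (ha : 0 < a) (hβ : 1 < β) :
    Summable fun k : ℕ => q ^ k * Real.exp (-(a * β ^ k)) := by
  have hβ0 : 0 < β := by linarith
  obtain ⟨n, hn⟩ := pow_unbounded_of_one_lt q hβ
  have hg : Summable fun k : ℕ => (n.factorial / a ^ n) * (q / β ^ n) ^ k :=
    (summable_geometric_of_lt_one (by positivity)
      ((div_lt_one (by positivity)).2 hn)).mul_left _
  refine Summable.of_nonneg_of_le (fun k => by positivity) (fun k => ?_) hg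
  have h1 := Real.pow_div_factorial_le_exp (x := a * β ^ k) (by positivity) n
  rw [Real.exp_neg]
  have h2 : (Real.exp (a * β ^ k))⁻¹ ≤ n.factorial / (a * β ^ k) ^ n := by
    rw [← inv_div]
    exact inv_anti₀ (by positivity) h1
  calc q ^ k * (Real.exp (a * β ^ k))⁻¹ ≤ q ^ k * (n.factorial / (a * β ^ k) ^ n) := by gcongr
    _ = (n.factorial / a ^ n) * (q / β ^ n) ^ k := by
      rw [mul_pow, div_pow, ← pow_mul, ← pow_mul, mul_comm k n]
      field_simp

theorem expNegDiv_ofReal {a b : ℝ} (ha : 0 ≤ a) (hb : 0 < b) :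
    expNegDiv (ENNReal.ofReal a) (ENNReal.ofReal b) = ENNReal.ofReal (Real.exp (-(a / b))) := by
  rw [expNegDiv, ← ENNReal.ofReal_div_of_pos hb, EReal.coe_ennreal_ofReal,
    max_eq_left (by positivity), ← EReal.coe_neg, EReal.exp_coe]

theorem expNegDiv_top {a : ℝ≥0∞} : expNegDiv a ∞ = 1 := by
  simp [expNegDiv]

/-- The gain of one dyadic level, to the power `1/2`. -/
noncomputable def dyadicGain (ε : ℝ) : ℝ := 2 ^ (ε / 2)

theorem one_lt_dyadicGain {ε : ℝ} (hε : 0 < ε) : 1 < dyadicGain ε :=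
  Real.one_lt_rpow one_lt_two (by positivity)

theorem sum_block_sq_le {ε : ℝ} (hε : 0 < ε) {u : Fin 2 → RealSeries} {M : ℝ}
    (hM : pairSobolevSq ε (u 0) (u 1) = ENNReal.ofReal (M ^ 2)) (k : ℕ) :
    ∑ p ∈ Finset.univ ×ˢ block k,
      (|u p.1 p.2| / japanese (freqNorm p.2.freq) ^ (p.1 : ℕ)) ^ 2
        ≤ (M / dyadicGain ε ^ (2 * k)) ^ 2 := by
  have hb : 0 < dyadicGain ε := zero_lt_one.trans (one_lt_dyadicGain hε)
  have hpow : (dyadicGain ε ^ (2 * k)) ^ 2 = (2 ^ k : ℝ) ^ (2 * ε) := by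
    rw [dyadicGain, ← pow_mul, ← Real.rpow_natCast, ← Real.rpow_mul (by norm_num),
      ← Real.rpow_natCast 2 k, ← Real.rpow_mul (by norm_num)]
    congr 1
    push_cast
    ring
  have hterm : ∀ (j : Fin 2), ∀ m ∈ block k,
      (dyadicGain ε ^ (2 * k)) ^ 2 * (|u j m| / japanese (freqNorm m.freq) ^ (j : ℕ)) ^ 2
        ≤ japanese (freqNorm m.freq) ^ (2 * (ε - (j : ℕ))) * u j m ^ 2 := by
    intro j m hm
    have hj := japanese_pos (freqNorm m.freq)
    have h := two_pow_level_le_japanese m.freq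
    rw [mem_block.1 hm] at h
    rw [hpow, mul_sub, Real.rpow_sub hj, div_pow, sq_abs, ← pow_mul,
      ← Real.rpow_natCast _ ((j : ℕ) * 2)]
    push_cast
    rw [mul_comm (2 : ℝ) ((j : ℕ) : ℝ), ← mul_div_assoc, mul_div_right_comm]
    gcongr
  have hsum : ∑ j : Fin 2, ∑ m ∈ block k,
      ENNReal.ofReal (japanese (freqNorm m.freq) ^ (2 * (ε - (j : ℕ))) * u j m ^ 2)
      ≤ ENNReal.ofReal (M ^ 2) := by
    rw [← hM, pairSobolevSq, Fin.sum_univ_two]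
    refine add_le_add ((ENNReal.sum_le_tsum _).trans_eq ?_) ((ENNReal.sum_le_tsum _).trans_eq ?_)
    · simp [sobolevSq]
    · simp [sobolevSq]
  have hnn : ∀ (j : Fin 2) (m : TrigMode),
      0 ≤ japanese (freqNorm m.freq) ^ (2 * (ε - (j : ℕ))) * u j m ^ 2 := fun j m =>
    mul_nonneg (Real.rpow_nonneg (japanese_pos _).le _) (sq_nonneg _)
  simp_rw [← ENNReal.ofReal_sum_of_nonneg fun m _ => hnn _ m] at hsum
  rw [← ENNReal.ofReal_sum_of_nonneg fun j _ => Finset.sum_nonneg fun m _ => hnn j m,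
    ENNReal.ofReal_le_ofReal_iff (sq_nonneg M)] at hsum
  rw [div_pow, le_div_iff₀ (by positivity), mul_comm, Finset.mul_sum, Finset.sum_product]
  exact (Finset.sum_le_sum fun j _ => Finset.sum_le_sum fun m hm => hterm j m hm).trans hsum

section

variable {T : ℝ} {φ : Fin 2 → ℝ → ℝ → ℝ} {u : Fin 2 → RealSeries}

/-- If the blocks of a wave are bounded by the terms of a geometric series, then the wave is a
bounded function. -/
theorem spaceTimeNorm_waveSeries_le (γ : Fin 2 × TrigMode → ℝ) {A b : ℝ} (hb : 1 < b)
    (hF : ∀ k, ∀ t ∈ Set.Icc 0 T, ∀ x,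
      |∑ p ∈ Finset.univ ×ˢ block k, waveTerm φ u p t x * γ p| ≤ A * b⁻¹ ^ k)
    {r : ℝ≥0∞} (hr : 2 ≤ r) :
    spaceTimeNorm T r (fun t => waveSeries φ (fun j m => γ (j, m) * u j m) t)
      ≤ ENNReal.ofReal ((1 + (2 * Real.pi) ^ 3) * (A * (1 - b⁻¹)⁻¹)) := by
  have hb0 : 0 < b := by linarith
  refine essSup_le_of_ae_le _ ?_
  filter_upwards [ae_restrict_mem measurableSet_Icc] with t ht
  set w := waveSeries φ (fun j m => γ (j, m) * u j m) t with hw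
  have hFw : ∀ k x, ∑ p ∈ Finset.univ ×ˢ block k, waveTerm φ u p t x * γ p
      = (∑ m ∈ block k, w m • modeFun m) x := by
    intro k x
    rw [Finset.sum_product_right, Finset.sum_apply]
    refine Finset.sum_congr rfl fun m _ => ?_
    simp only [hw, waveSeries, waveTerm, Pi.smul_apply, smul_eq_mul, Finset.sum_mul]
    exact Finset.sum_congr rfl fun j _ => by ring
  have hgeom : HasSum (fun k : ℕ => A * b⁻¹ ^ k) (A * (1 - b⁻¹)⁻¹) :=
    (hasSum_geometric_of_lt_one (by positivity) (inv_lt_one_of_one_lt₀ hb)).mul_left A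
  have hbd : ∀ k x, |(∑ m ∈ block k, w m • modeFun m) x| ≤ A * b⁻¹ ^ k := fun k x => by
    rw [← hFw]
    exact hF k t ht x
  have hrep := represents_tsum (F := fun k => ∑ m ∈ block k, w m • modeFun m)
    (w := fun k => ∑ m ∈ block k, w m • unitSeries m) (u := w)
    (fun k => by
      rw [show (∑ m ∈ block k, w m • modeFun m) = fun x => ∑ m ∈ block k, w m * modeFun m x by
        funext x; simp]
      exact continuous_finsetSum _ fun m _ => continuous_const.mul (continuous_modeFun m))
    hbd hgeom.summable
    (fun k => represents_sum _ _ _ fun m _ => (represents_modeFun m).smul _)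
    (hasSum_fourierCoefficient_block w)
  exact spaceNorm_le_of_abs_le hrep
    (fun x => (Real.norm_eq_abs _).symm.trans_le (tsum_of_norm_bounded hgeom fun k => hbd k x)) hr

variable {Ω : Type*} [MeasurableSpace Ω] {P : Measure Ω} {θ : Measure ℝ} {K : ℝ}
  {g : Fin 2 → TrigMode → Ω → ℝ}

/-- The samples for which some random variable of level `k`, or the block of level `k` at some
point of the grid, is large. -/
def badEvent (T : ℝ) (φ : Fin 2 → ℝ → ℝ → ℝ) (u : Fin 2 → RealSeries)
    (g : Fin 2 → TrigMode → Ω → ℝ) (k : ℕ) (V y : ℝ) : Set Ω :=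
  (⋃ p ∈ Finset.univ ×ˢ block k, {ω | y < |g p.1 p.2 ω|}) ∪
    ⋃ a : GridIndex k, {ω | 2 * max 1 T * V * y
      < |∑ p ∈ Finset.univ ×ˢ block k, waveTerm φ u p (gridTime T a) (gridPoint a) * g p.1 p.2 ω|}

theorem measure_badEvent_le (hT : 0 < T) (hφ : IsWaveSymbol T φ) (h : IsRandomizer P θ K g)
    (hK : 0 < K) (k : ℕ) {V y : ℝ} (hV : 0 < V) (hy : 0 ≤ y)
    (hu : ∑ p ∈ Finset.univ ×ˢ block k,
      (|u p.1 p.2| / japanese (freqNorm p.2.freq) ^ (p.1 : ℕ)) ^ 2 ≤ V ^ 2) :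
    P (badEvent T φ u g k V y)
      ≤ ENNReal.ofReal (6176 * 65536 ^ k * Real.exp (-(y ^ 2 / (4 * K)))) := by
  have h1 : P (⋃ p ∈ Finset.univ ×ˢ block k, {ω | y < |g p.1 p.2 ω|})
      ≤ (3072 * 8 ^ k : ℕ) * ENNReal.ofReal (2 * Real.exp (-(y ^ 2 / (4 * K)))) := by
    refine (measure_biUnion_finset_le _ _).trans
      ((Finset.sum_le_sum fun p _ => h.measure_abs_gt_le hK p hy).trans ?_)
    rw [Finset.sum_const, nsmul_eq_mul]
    gcongr
    exact card_univ_product_block_le k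
  have h2 : P (⋃ a : GridIndex k, {ω | 2 * max 1 T * V * y
      < |∑ p ∈ Finset.univ ×ˢ block k,
        waveTerm φ u p (gridTime T a) (gridPoint a) * g p.1 p.2 ω|})
      ≤ (16 * 65536 ^ k : ℕ) * ENNReal.ofReal (2 * Real.exp (-(y ^ 2 / (4 * K)))) := by
    refine (measure_iUnion_fintype_le _ _).trans
      ((Finset.sum_le_sum fun a _ => h.measure_abs_sum_gt_le hK _
        (fun p => waveTerm φ u p (gridTime T a) (gridPoint a)) (by positivity) ?_ hy).trans ?_)
    · rw [mul_pow]
      refine le_trans ?_ (mul_le_mul_of_nonneg_left hu (by positivity))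
      rw [Finset.mul_sum]
      refine Finset.sum_le_sum fun p _ => ?_
      rw [← mul_pow, ← sq_abs]
      gcongr
      exact abs_waveTerm_le hφ p (gridTime_mem hT a) _
    · rw [Finset.sum_const, nsmul_eq_mul]
      gcongr
      rw [Finset.card_univ, Fintype.card_prod, Fintype.card_fun, Fintype.card_fin,
        Fintype.card_fin]
      have : 16 ^ k + 1 ≤ 2 * 16 ^ k := by
        have : 1 ≤ 16 ^ k := Nat.one_le_pow _ _ (by norm_num)
        omega
      calc (16 ^ k + 1) * (16 ^ k + 1) ^ 3 = (16 ^ k + 1) ^ 4 := by ring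
        _ ≤ (2 * 16 ^ k) ^ 4 := by gcongr
        _ = 16 * 65536 ^ k := by
          rw [mul_pow, ← pow_mul, mul_comm k 4, pow_mul]; norm_num
  refine (measure_union_le _ _).trans ((add_le_add h1 h2).trans ?_)
  rw [← add_mul, ← Nat.cast_add, ← ENNReal.ofReal_natCast, ← ENNReal.ofReal_mul (by positivity)]
  apply ENNReal.ofReal_le_ofReal
  push_cast
  have h8 : (8 : ℝ) ^ k ≤ 65536 ^ k := by gcongr; norm_num
  have he := Real.exp_pos (-(y ^ 2 / (4 * K)))
  nlinarith

/-- The constant of the deterministic estimate. -/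
noncomputable def supConst (ε : ℝ) : ℝ :=
  (1 + (2 * Real.pi) ^ 3) * (400000 * (1 - (dyadicGain ε)⁻¹)⁻¹)

theorem supConst_pos {ε : ℝ} (hε : 0 < ε) : 0 < supConst ε := by
  have h := inv_lt_one_of_one_lt₀ (one_lt_dyadicGain hε)
  have : 0 < (1 - (dyadicGain ε)⁻¹)⁻¹ := inv_pos.2 (by linarith)
  unfold supConst
  positivity

/-- The constant of the union bound. -/
noncomputable def unionConst (K ε : ℝ) : ℝ :=
  ∑' k : ℕ, 6176 * (65536 ^ k * Real.exp (-(1 / (8 * K) * (dyadicGain ε ^ 2) ^ k)))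

theorem measure_spaceTimeNorm_gt_le (hT : 0 < T) (hφ : IsWaveSymbol T φ)
    (h : IsRandomizer P θ K g) (hK : 0 < K) {ε : ℝ} (hε : 0 < ε) {M : ℝ} (hM0 : 0 < M)
    (hM : pairSobolevSq ε (u 0) (u 1) = ENNReal.ofReal (M ^ 2)) {r : ℝ≥0∞} (hr : 2 ≤ r)
    {μ : ℝ} (hμ : 1 ≤ μ) :
    P {ω | ENNReal.ofReal (supConst ε * (max 1 T * M * μ))
        < spaceTimeNorm T r (waveSeries φ fun j m => g j m ω * u j m)}
      ≤ ENNReal.ofReal (unionConst K ε * Real.exp (-(μ ^ 2 / (8 * K)))) := by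
  set b := dyadicGain ε with hbdef
  have hb : 1 < b := one_lt_dyadicGain hε
  have hb0 : 0 < b := by linarith
  have hμ0 : 0 < μ := by linarith
  have hu := sum_block_sq_le hε hM
  have hsub : {ω | ENNReal.ofReal (supConst ε * (max 1 T * M * μ))
        < spaceTimeNorm T r (waveSeries φ fun j m => g j m ω * u j m)}
      ⊆ ⋃ k, badEvent T φ u g k (M / b ^ (2 * k)) (μ * b ^ k) := by
    intro ω hω
    by_contra hgood
    simp only [badEvent, Set.mem_iUnion, Set.mem_union, Set.mem_ofPred_eq, not_exists, not_or,
      not_lt] at hgood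
    refine absurd (Set.mem_ofPred_eq ▸ hω) (not_lt.2 ?_)
    have hF : ∀ k, ∀ t ∈ Set.Icc 0 T, ∀ x,
        |∑ p ∈ Finset.univ ×ˢ block k, waveTerm φ u p t x * g p.1 p.2 ω|
          ≤ 400000 * max 1 T * M * μ * b⁻¹ ^ k := by
      intro k t ht x
      have hV : 0 ≤ M / b ^ (2 * k) := by positivity
      refine (abs_blockSum_le hT hφ k (by positivity) hV (fun p => g p.1 p.2 ω)
        (fun p hp => ?_) (hgood k).1 (hgood k).2 ht x).trans_eq ?_
      · have hj := japanese_pos (freqNorm p.2.freq)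
        refine (sq_le_sq₀ (by positivity) hV).1 ((Finset.single_le_sum
          (f := fun p : Fin 2 × TrigMode =>
          (|u p.1 p.2| / japanese (freqNorm p.2.freq) ^ (p.1 : ℕ)) ^ 2)
          (fun _ _ => sq_nonneg _) hp).trans (hu k))
      · rw [two_mul k, pow_add, inv_pow]
        field_simp
    refine (spaceTimeNorm_waveSeries_le (fun p => g p.1 p.2 ω) hb hF hr).trans_eq ?_
    rw [supConst]
    congr 1
    ring
  refine (measure_mono hsub).trans ((measure_iUnion_le _).trans ?_)
  have hsum : Summable fun k : ℕ =>
      6176 * ((65536 : ℝ) ^ k * Real.exp (-(1 / (8 * K) * (b ^ 2) ^ k))) :=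
    (summable_pow_mul_exp_neg (by norm_num) (by positivity)
      (one_lt_pow₀ hb two_ne_zero)).mul_left _
  rw [unionConst, ← tsum_mul_right, ENNReal.ofReal_tsum_of_nonneg (fun k => by positivity)
    (hsum.mul_right _)]
  refine ENNReal.tsum_le_tsum fun k => ?_
  refine (measure_badEvent_le hT hφ h hK k (by positivity) (by positivity) (hu k)).trans ?_
  apply ENNReal.ofReal_le_ofReal
  rw [mul_assoc, mul_assoc, mul_assoc, ← Real.exp_add]
  gcongr
  have h1 : 1 ≤ (b ^ 2) ^ k := one_le_pow₀ (one_le_pow₀ hb.le)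
  have h2 : 1 ≤ μ ^ 2 := one_le_pow₀ hμ
  have h3 : (μ * b ^ k) ^ 2 = μ ^ 2 * (b ^ 2) ^ k := by
    rw [mul_pow, ← pow_mul, ← pow_mul, mul_comm k 2]
  rw [h3, ← neg_add, neg_le_neg_iff, le_div_iff₀ (by positivity)]
  have h4 : (1 / (8 * K) * (b ^ 2) ^ k + μ ^ 2 / (8 * K)) * (4 * K)
      = ((b ^ 2) ^ k + μ ^ 2) / 2 := by
    field_simp
    ring
  rw [h4]
  nlinarith

end

theorem eq_zero_of_sobolevSq_eq_zero {s : ℝ} {u : RealSeries} (h : sobolevSq s u = 0) : u = 0 := by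
  funext m
  have hm := ENNReal.tsum_eq_zero.1 h m
  rw [ENNReal.ofReal_eq_zero] at hm
  have hp := Real.rpow_pos_of_pos (japanese_pos (freqNorm m.freq)) (2 * s)
  have h2 : u m ^ 2 ≤ 0 := nonpos_of_mul_nonpos_right hm hp
  exact pow_eq_zero_iff two_ne_zero |>.1 (le_antisymm h2 (sq_nonneg _))

theorem spaceTimeNorm_zero (T : ℝ) {r : ℝ≥0∞} (hr : 2 ≤ r) :
    spaceTimeNorm T r (fun _ => 0) = 0 := by
  have h : spaceNorm r 0 ≤ 0 := by
    simpa using spaceNorm_le_of_abs_le represents_zero (A := 0) (by simp) hr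
  exact le_antisymm (essSup_le_of_ae_le _ (ae_of_all _ fun t => h)) zero_le

end RandomWave

open RandomWave in
theorem mainTheorem7 (K : ℝ) (hK : 0 < K) (r : ℝ≥0∞) (hr : 2 ≤ r) (ε : ℝ) (hε : 0 < ε) :
    ∃ C c : ℝ, 0 < C ∧ 0 < c ∧
      ∀ (Ω : Type*) [MeasurableSpace Ω] (P : Measure Ω) [IsProbabilityMeasure P]
        (θ : Measure ℝ) (g : Fin 2 → TrigMode → Ω → ℝ), IsRandomizer P θ K g →
      ∀ (s : ℝ) (u₀ u₁ : RealSeries), MemPairSobolev s u₀ u₁ →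
      ∀ (T : ℝ), 0 < T →
      ∀ (Sstar : ℝ → RealSeries → RealSeries → RealSeries),
        Sstar = waveS ∨ Sstar = waveSTilde →
      ∀ (lam : ℝ), 0 < lam →
        P {ω | ENNReal.ofReal lam <
            spaceTimeNorm T r
              (fun t => Sstar t (randomize (g 0) u₀ ω) (randomize (g 1) u₁ ω))}
          ≤ ENNReal.ofReal C *
            expNegDiv (ENNReal.ofReal (c * lam ^ 2))
              (ENNReal.ofReal (max 1 (T ^ 2)) * pairSobolevSq ε u₀ u₁) := by
  have hU : 0 ≤ unionConst K ε := tsum_nonneg fun k => by positivity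
  have hD := supConst_pos hε
  refine ⟨unionConst K ε + Real.exp (1 / (8 * K)), 1 / (8 * K * supConst ε ^ 2), by positivity,
    by positivity, ?_⟩
  intro Ω _ P _ θ g hg s u₀ u₁ _ T hT Sstar hS lam hlam
  have hC1 : (1 : ℝ≥0∞) ≤ ENNReal.ofReal (unionConst K ε + Real.exp (1 / (8 * K))) := by
    rw [ENNReal.one_le_ofReal]
    have : 1 ≤ Real.exp (1 / (8 * K)) := Real.one_le_exp (by positivity)
    linarith
  obtain ⟨φ, hφ, hSφ⟩ := exists_isWaveSymbol hS T
  have hw : ∀ ω, (fun t => Sstar t (randomize (g 0) u₀ ω) (randomize (g 1) u₁ ω))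
      = waveSeries φ fun j m => g j m ω * (![u₀, u₁] : Fin 2 → RealSeries) j m := by
    intro ω
    funext t
    rw [hSφ]
    congr 1
    funext j
    fin_cases j <;> rfl
  have hmax : 0 < max 1 (T ^ 2) := lt_max_of_lt_left one_pos
  rcases eq_or_ne (pairSobolevSq ε u₀ u₁) ∞ with htop | htop
  · rw [htop, ENNReal.mul_top (by simp), expNegDiv_top, mul_one]
    exact prob_le_one.trans hC1
  rcases eq_or_ne (pairSobolevSq ε u₀ u₁) 0 with hzero | hzero
  · obtain ⟨h0, h1⟩ := add_eq_zero.1 hzero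
    have e0 := eq_zero_of_sobolevSq_eq_zero h0
    have e1 := eq_zero_of_sobolevSq_eq_zero h1
    have hempty : {ω | ENNReal.ofReal lam < spaceTimeNorm T r
        (fun t => Sstar t (randomize (g 0) u₀ ω) (randomize (g 1) u₁ ω))} = ∅ := by
      refine Set.eq_empty_of_forall_notMem fun ω => ?_
      rw [Set.mem_ofPred_eq, not_lt]
      have hz : (fun t => Sstar t (randomize (g 0) u₀ ω) (randomize (g 1) u₁ ω))
          = fun _ => 0 := by
        rw [hw, e0, e1]
        funext t m
        simp [waveSeries]
      rw [hz, spaceTimeNorm_zero T hr]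
      exact zero_le
    rw [hempty, measure_empty]
    exact zero_le
  set M := Real.sqrt (pairSobolevSq ε u₀ u₁).toReal with hMdef
  have hpos : 0 < (pairSobolevSq ε u₀ u₁).toReal := ENNReal.toReal_pos hzero htop
  have hM0 : 0 < M := Real.sqrt_pos.2 hpos
  have hM : pairSobolevSq ε u₀ u₁ = ENNReal.ofReal (M ^ 2) := by
    rw [hMdef, Real.sq_sqrt hpos.le, ENNReal.ofReal_toReal htop]
  have hB : max 1 (T ^ 2) = (max 1 T) ^ 2 := by
    rcases le_total 1 T with h | h
    · rw [max_eq_right h, max_eq_right (one_le_pow₀ h)]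
    · rw [max_eq_left h, max_eq_left (pow_le_one₀ hT.le h), one_pow]
  have hB0 : 0 < max 1 T := lt_max_of_lt_left one_pos
  set μ := lam / (supConst ε * (max 1 T * M)) with hμdef
  have hμ0 : 0 < μ := by positivity
  have hexp : 1 / (8 * K * supConst ε ^ 2) * lam ^ 2 / (max 1 T ^ 2 * M ^ 2)
      = μ ^ 2 / (8 * K) := by
    rw [hμdef]
    field_simp
  rw [hM, hB, ← ENNReal.ofReal_mul (by positivity), expNegDiv_ofReal (by positivity)
    (by positivity), hexp, ← ENNReal.ofReal_mul (by positivity)]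
  rcases le_or_gt 1 μ with h1 | h1
  · have hmain := measure_spaceTimeNorm_gt_le (u := ![u₀, u₁]) hT hφ hg hK hε hM0 hM hr h1
    have hlamμ : supConst ε * (max 1 T * M * μ) = lam := by
      rw [hμdef]
      field_simp
    rw [hlamμ] at hmain
    simp_rw [hw]
    refine hmain.trans (ENNReal.ofReal_le_ofReal ?_)
    gcongr
    exact le_add_of_nonneg_right (Real.exp_pos _).le
  · refine prob_le_one.trans ?_
    rw [ENNReal.one_le_ofReal, add_mul, ← Real.exp_add]
    have h2 : μ ^ 2 / (8 * K) ≤ 1 / (8 * K) := by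
      gcongr
      exact pow_le_one₀ hμ0.le h1.le
    have h3 : 1 ≤ Real.exp (1 / (8 * K) + -(μ ^ 2 / (8 * K))) := Real.one_le_exp (by linarith)
    have h4 : 0 ≤ unionConst K ε * Real.exp (-(μ ^ 2 / (8 * K))) := by positivity
    linarith
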